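/- Let $\tau=2143$. A permutation $\sigma=\sigma_1\cdots\sigma_n$ of $\{1,\dots,n\}$ has an occurrence of $\tau$ at position $i$ if $1\le i\le n-3$ and the entries $\sigma_i\sigma_{i+1}\sigma_{i+2}\sigma_{i+3}$ are in the same relative order as $2143$. For $l\ge1$, an $l$-cluster of length $n$ is a pair $(\sigma;i_1,\dots,i_l)$, where $\sigma$ is a permutation of length $n$ that has an occurrence of $\tau$ at each $i_j$, such that $i_1=1$, $i_j<i_{j+1}<i_j+4$ for $1\le j<l$, and $n=i_l+3$; the permutation of length $1$ is, by convention, the only $0$-cluster. Let $c_{n,l}$ be the number of $l$-clusters of length $n$, and $c_{n,l}(p)$ the number of those with $\sigma_1=p$. Let $\pi_{n,k}$ be the number of permutations of length $n$ with exactly $k$ occurrences of $\tau$. Theorem. For all $n\ge2$ and $l\ge0$, $$c_{n,l}=\sum_{2\le p\le n-2}c_{n,l}(p).$$ The numbers $c_{n,l}(p)$ ($n\ge1$, $l\ge0$, $p\ge1$) satisfy the initial conditions $c_{1,l}(p)=\delta_{0,l}\delta_{1,p}$, $c_{2,l}(p)=0$, $c_{3,l}(p)=0$, and for all $n\ge4$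 the recurrence $$c_{n,l}(p)=\sum_{\substack{1\le k\le l\\ 2k+2\le n}}\ \sum_{\substack{2k+1\le q\le n\\ q>p}}\binom{q-p-1}{2k-2}(p-1)(n-q)\,c_{n-2k-1,\,l-k}(q-2k).$$ Moreover, the generating function for occurrences of $2143$ is given, as a power series in $x$ over $\mathbb Q[t]$, by $$\sum_{n,k\ge0}\pi_{n,k}\frac{x^n}{n!}t^k=\left(1-x-\sum_{n\ge2,\,l\ge1}\frac{c_{n,l}\,x^n(t-1)^l}{n!}\right)^{-1}.$$ -/

import Mathlib

open Equiv Polynomial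

/-- The window `σ_{i+1} σ_{i+2} … σ_{i+r}` of the permutation `σ` (of length `n`) exists and its
standardization is `τ`: its entries are in the same relative order as those of `τ`.
Positions and values are counted from `0`. -/
def IsOccurrence {r n : ℕ} (τ : Perm (Fin r)) (σ : Perm (Fin n)) (i : Fin n) : Prop :=
  ∃ h : (i : ℕ) + r ≤ n, ∀ a b : Fin r,
    σ ⟨(i : ℕ) + a, by omega⟩ < σ ⟨(i : ℕ) + b, by omega⟩ ↔ τ a < τ b

/-- The number of consecutive occurrences of the pattern `τ` in `σ`. -/
noncomputable def occurrenceCount {r n : ℕ} (τ : Perm (Fin r)) (σ : Perm (Fin n)) : ℕ :=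
  {i : Fin n | IsOccurrence τ σ i}.ncard

/-- The number `π_{n,k}` of permutations of length `n` with exactly `k` consecutive occurrences
of `τ`. -/
noncomputable def permCount {r : ℕ} (τ : Perm (Fin r)) (n k : ℕ) : ℕ :=
  {σ : Perm (Fin n) | occurrenceCount τ σ = k}.ncard

/-- `(σ, i)` is an `l`-cluster of length `n` for the pattern `τ` of length `r`: `i` lists the
starting positions of `l` marked occurrences of `τ` in `σ` from left to right, neighbours in the
list overlap, the first starts at the beginning and the last ends at the end of `σ`.
For `l = 0` the convention is that the permutation of length `1` is the only `0`-cluster. -/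
structure IsCluster {r n l : ℕ} (τ : Perm (Fin r)) (σ : Perm (Fin n)) (i : Fin l → Fin n) :
    Prop where
  occ : ∀ k : Fin l, IsOccurrence τ σ (i k)
  linked : ∀ (k : ℕ) (hk : k + 1 < l),
    (i ⟨k, by omega⟩ : ℕ) < i ⟨k + 1, hk⟩ ∧ (i ⟨k + 1, hk⟩ : ℕ) < i ⟨k, by omega⟩ + r
  first : ∀ hl : 0 < l, (i ⟨0, hl⟩ : ℕ) = 0
  last : ∀ hl : 0 < l, n = (i ⟨l - 1, by omega⟩ : ℕ) + r
  zero : l = 0 → n = 1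

/-- The cluster number `cl_{n,l}`: the number of `l`-clusters of length `n`. -/
noncomputable def clusterCount {r : ℕ} (τ : Perm (Fin r)) (n l : ℕ) : ℕ :=
  {x : Perm (Fin n) × (Fin l → Fin n) | IsCluster τ x.1 x.2}.ncard

/-- The number of `l`-clusters of length `n` whose permutation has first entry `p`
(entries being `1, …, n`). -/
noncomputable def clusterCountFirst {r : ℕ} (τ : Perm (Fin r)) (n l p : ℕ) : ℕ :=
  {x : Perm (Fin n) × (Fin l → Fin n) |
    IsCluster τ x.1 x.2 ∧ ∃ h : 0 < n, (x.1 ⟨0, h⟩ : ℕ) + 1 = p}.ncard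

/-- A permutation of length `n` has at most `n` occurrences, so that `π_{n,k} = 0` for `k > n`. -/
theorem permCount_eq_zero {r : ℕ} (τ : Perm (Fin r)) {n k : ℕ} (h : n < k) :
    permCount τ n k = 0 := by
  unfold permCount
  rw [Set.ncard_eq_zero]
  ext σ
  simp only [Set.mem_ofPred_eq, Set.mem_empty_iff_false, iff_false]
  have h1 : occurrenceCount τ σ ≤ Nat.card (Fin n) := Set.ncard_le_card _
  rw [Nat.card_fin] at h1
  omega

/-- The marked positions are distinct, so that `cl_{n,l} = 0` for `l > n`. -/
theorem clusterCount_eq_zero {r : ℕ} (τ : Perm (Fin r)) {n l : ℕ} (h : n < l) :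
    clusterCount τ n l = 0 := by
  unfold clusterCount
  rw [Set.ncard_eq_zero]
  ext ⟨σ, i⟩
  simp only [Set.mem_ofPred_eq, Set.mem_empty_iff_false, iff_false]
  intro hc
  have key : ∀ (k : ℕ) (hk : k < l), k ≤ (i ⟨k, hk⟩ : ℕ) := by
    intro k
    induction k with
    | zero => intro _; exact Nat.zero_le _
    | succ k ih =>
      intro hk
      have h1 := ih (by omega)
      have h2 := (hc.linked k hk).1
      omega
  have h1 := key n h
  have h2 := (i ⟨n, h⟩).isLt
  omega

/-- `Π(x,t) = ∑_{n,k} π_{n,k} (x^n / n!) t^k`, a power series in `x` over the polynomials in `t`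
(the coefficients with `k > n` vanish by `permCount_eq_zero`). -/
noncomputable def occurrenceGF {r : ℕ} (τ : Perm (Fin r)) : PowerSeries ℚ[X] :=
  PowerSeries.mk fun n =>
    ∑ k ∈ Finset.range (n + 1), C ((permCount τ n k : ℚ) / (n.factorial : ℚ)) * X ^ k

/-- `∑_{n ≥ 2, l ≥ 1} cl_{n,l} (x^n / n!) (t - 1)^l`, a power series in `x` over the polynomials
in `t` (the coefficients with `l > n` vanish by `clusterCount_eq_zero`). -/
noncomputable def clusterGFShifted {r : ℕ} (τ : Perm (Fin r)) : PowerSeries ℚ[X] :=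
  PowerSeries.mk fun n =>
    if 2 ≤ n then
      ∑ l ∈ Finset.Icc 1 n, C ((clusterCount τ n l : ℚ) / (n.factorial : ℚ)) * (X - 1) ^ l
    else 0

/-- The permutation `2143`. -/
def perm2143 : Perm (Fin 4) where
  toFun := ![1, 0, 3, 2]
  invFun := ![1, 0, 3, 2]
  left_inv := by decide
  right_inv := by decide

/-! Both halves become identities about words of distinct letters. They pass to permutations because
the statistics involved depend only on the relative order of the letters.

Generating function (cluster method): with `u = t - 1`, the power `(1 + u) ^ wordOccurrences w` sums
`u` to the number of marked occurrences over all sets of marked occurrences. Grouping overlapping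
marked occurrences cuts the word uniquely into clusters, a lone letter being a 0-cluster. Splitting
off the first cluster (`pow_wordOccurrences_eq_sum`) and summing over all words gives a binomial
convolution, which is the required product of exponential series. Two occurrences of 2143 cannot
start one place apart, so neighbours in a cluster are 2 or 3 places apart; hence the two-term
recursion in `wordClusters`.

Recurrence: let the cluster begin with exactly `k` marked occurrences at successive distance 2. They
cover `2k + 2` letters, and swapping each pair of neighbouring letters makes this prefix increasing
(`isRun_iff_isChain`). So it reads `p a u d q` with `a < p < u < q < d`, where `u` is an increasing
sequence with its pairs swapped. The letter `a` can be chosen in `p - 1` ways, `d` in `n - q` ways,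
and the set of letters of `u` in `(q - p - 1).choose (2k - 2)` ways. The rest is a cluster starting
at the shared letter `q`. Of the removed letters only `d` exceeds `q`, so the rank of `q` falls by
`2k`. -/

/-! ### Words on a finite alphabet and order-invariant statistics -/

/-- The words without repeated letters whose set of letters is `A`. -/
noncomputable def words (A : Finset ℕ) : Finset (List ℕ) := A.toList.permutations.toFinset

theorem mem_words {A : Finset ℕ} {w : List ℕ} : w ∈ words A ↔ w.Nodup ∧ w.toFinset = A := by
  unfold words
  rw [List.mem_toFinset, List.mem_permutations]
  constructor
  · intro h
    refine ⟨h.nodup_iff.2 A.nodup_toList, ?_⟩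
    rw [List.toFinset_eq_of_perm _ _ h, Finset.toList_toFinset]
  · rintro ⟨hn, rfl⟩
    exact (List.toFinset_toList hn).symm

theorem words_empty : words ∅ = {[]} := by
  ext w
  simp only [mem_words, List.toFinset_eq_empty_iff, Finset.mem_singleton]
  exact ⟨And.right, by rintro rfl; simp⟩

theorem length_of_mem_words {A : Finset ℕ} {w : List ℕ} (h : w ∈ words A) :
    w.length = A.card := by
  obtain ⟨hn, rfl⟩ := mem_words.1 h
  exact (List.toFinset_card_of_nodup hn).symm

theorem mem_of_mem_words {A : Finset ℕ} {w : List ℕ} (h : w ∈ words A) (x : ℕ) :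
    x ∈ w ↔ x ∈ A := by
  obtain ⟨hn, rfl⟩ := mem_words.1 h
  exact List.mem_toFinset.symm

/-- Cutting the words on `A` after `m` letters. -/
theorem sum_words_take_drop {R : Type*} [AddCommMonoid R] (A : Finset ℕ) (m : ℕ) (hm : m ≤ A.card)
    (G : List ℕ → List ℕ → R) :
    ∑ w ∈ words A, G (w.take m) (w.drop m) =
      ∑ B ∈ A.powersetCard m, ∑ v ∈ words B, ∑ w ∈ words (A \ B), G v w := by
  simp_rw [← Finset.sum_product']
  rw [Finset.sum_sigma']
  refine Finset.sum_bij' (fun w _ => ⟨(w.take m).toFinset, (w.take m, w.drop m)⟩)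
    (fun x _ => x.2.1 ++ x.2.2) ?_ ?_ ?_ ?_ ?_
  · intro w hw
    obtain ⟨hn, rfl⟩ := mem_words.1 hw
    have hl := length_of_mem_words hw
    have hd : (w.take m ++ w.drop m).Nodup := by rwa [List.take_append_drop]
    rw [List.nodup_append] at hd
    simp only [Finset.mem_sigma, Finset.mem_powersetCard, Finset.mem_product, mem_words]
    refine ⟨⟨?_, ?_⟩, ⟨hd.1, trivial⟩, hd.2.1, ?_⟩
    · intro x hx
      rw [List.mem_toFinset] at hx ⊢
      exact List.mem_of_mem_take hx
    · rw [List.toFinset_card_of_nodup hd.1, List.length_take]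
      omega
    · ext x
      simp only [List.mem_toFinset, Finset.mem_sdiff]
      constructor
      · intro hx
        exact ⟨List.mem_of_mem_drop hx, fun h => hd.2.2 x h x hx rfl⟩
      · rintro ⟨h1, h2⟩
        rw [← List.take_append_drop m w, List.mem_append] at h1
        exact h1.resolve_left h2
  · rintro ⟨B, v, w⟩ hx
    simp only [Finset.mem_sigma, Finset.mem_powersetCard, Finset.mem_product, mem_words] at hx
    obtain ⟨⟨hB, hc⟩, ⟨hv, rfl⟩, hw, hw'⟩ := hx
    refine mem_words.2 ⟨?_, ?_⟩
    · rw [List.nodup_append]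
      refine ⟨hv, hw, ?_⟩
      rintro a ha _ hb rfl
      have : a ∈ w.toFinset := List.mem_toFinset.2 hb
      rw [hw', Finset.mem_sdiff, List.mem_toFinset] at this
      exact this.2 ha
    · rw [List.toFinset_append, hw', Finset.union_sdiff_of_subset hB]
  · intro w _
    exact List.take_append_drop m w
  · rintro ⟨B, v, w⟩ hx
    simp only [Finset.mem_sigma, Finset.mem_powersetCard, Finset.mem_product, mem_words] at hx
    obtain ⟨⟨hB, hc⟩, ⟨hv, rfl⟩, hw, hw'⟩ := hx
    rw [List.toFinset_card_of_nodup hv] at hc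
    subst hc
    simp
  · intro w _
    rfl

/-- Relabelling the letters of the words on `A` along an injection. -/
theorem sum_words_image {R : Type*} [AddCommMonoid R] (A : Finset ℕ) (g : ℕ → ℕ)
    (hg : Set.InjOn g A) (F : List ℕ → R) :
    ∑ w ∈ words (A.image g), F w = ∑ w ∈ words A, F (w.map g) := by
  symm
  refine Finset.sum_bij (fun w _ => w.map g) ?_ ?_ ?_ ?_
  · intro w hw
    obtain ⟨hn, rfl⟩ := mem_words.1 hw
    refine mem_words.2 ⟨?_, ?_⟩
    · refine hn.map_on ?_
      intro x hx y hy h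
      exact hg (by simpa using hx) (by simpa using hy) h
    · ext x
      simp
  · intro v hv w hw h
    obtain ⟨-, rfl⟩ := id (mem_words.1 hv)
    rw [← List.map_id v, ← List.map_id w]
    have hid : ∀ z ∈ words v.toFinset, z.map id =
        (z.map g).map (Function.invFunOn g v.toFinset) := by
      intro z hz
      rw [List.map_map]
      refine List.map_congr_left fun x hx => ?_
      exact (hg.leftInvOn_invFunOn ((mem_of_mem_words hz x).1 hx)).symm
    rw [hid v hv, hid w hw, h]
  · intro w hw
    obtain ⟨hn, hA⟩ := mem_words.1 hw
    have hx : ∀ x ∈ w, ∃ y ∈ A, g y = x := by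
      intro x hx
      simpa using (mem_of_mem_words hw x).1 hx
    refine ⟨w.map (Function.invFunOn g A), ?_, ?_⟩
    · refine mem_words.2 ⟨?_, ?_⟩
      · refine hn.map_on ?_
        intro x hx' y hy' h
        rw [← Function.invFunOn_eq (hx x hx'), h, Function.invFunOn_eq (hx y hy')]
      · ext a
        simp only [List.mem_toFinset, List.mem_map]
        constructor
        · rintro ⟨x, hx', rfl⟩
          exact Function.invFunOn_mem (hx x hx')
        · intro ha
          have : g a ∈ w := (mem_of_mem_words hw _).2 (Finset.mem_image_of_mem g ha)
          exact ⟨g a, this, hg (Function.invFunOn_mem (hx _ this)) ha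
            (Function.invFunOn_eq (hx _ this))⟩
    · rw [List.map_map]
      conv_rhs => rw [← List.map_id w]
      refine List.map_congr_left ?_
      intro x hx'
      exact Function.invFunOn_eq (hx x hx')
  · intro w _
    rfl

/-- The rank of `x` among the elements of `A`, counted from `1`. -/
def rankIn (A : Finset ℕ) (x : ℕ) : ℕ := (A.filter (· ≤ x)).card

theorem rankIn_strictMonoOn (A : Finset ℕ) : StrictMonoOn (rankIn A) A := by
  intro x _ y hy h
  refine Finset.card_lt_card ⟨?_, ?_⟩
  · intro z hz
    simp only [Finset.mem_filter] at hz ⊢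
    exact ⟨hz.1, by omega⟩
  · intro hs
    have := hs (Finset.mem_filter.2 ⟨hy, le_refl y⟩)
    simp only [Finset.mem_filter] at this
    omega

theorem image_rankIn (A : Finset ℕ) : A.image (rankIn A) = Finset.Icc 1 A.card := by
  refine Finset.eq_of_subset_of_card_le ?_ ?_
  · intro y hy
    obtain ⟨x, hx, rfl⟩ := Finset.mem_image.1 hy
    refine Finset.mem_Icc.2 ⟨?_, Finset.card_filter_le _ _⟩
    exact Finset.card_pos.2 ⟨x, Finset.mem_filter.2 ⟨hx, le_refl x⟩⟩
  · rw [Finset.card_image_of_injOn (rankIn_strictMonoOn A).injOn]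
    simp

/-- A statistic on words that only depends on the relative order of the letters. -/
def OrderInvariant {R : Type*} (F : List ℕ → R) : Prop :=
  ∀ (w : List ℕ) (g : ℕ → ℕ), StrictMonoOn g {x | x ∈ w} → F (w.map g) = F w

/-- Replacing each letter by its rank in `A` is strictly increasing on `A`, so it does not change
`F`. -/
theorem OrderInvariant.sum_words {R : Type*} [AddCommMonoid R] {F : List ℕ → R}
    (hF : OrderInvariant F) (A : Finset ℕ) :
    ∑ w ∈ words A, F w = ∑ w ∈ words (Finset.Icc 1 A.card), F w := by
  rw [← image_rankIn, sum_words_image _ _ (rankIn_strictMonoOn A).injOn]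
  refine Finset.sum_congr rfl fun w hw => (hF _ _ ?_).symm
  intro x hx y hy h
  exact rankIn_strictMonoOn A ((mem_of_mem_words hw _).1 hx) ((mem_of_mem_words hw _).1 hy) h

/-- The same relabelling by rank, keeping track of a prescribed first letter. The recurrence uses it
for the part of the word that starts at `q`. -/
theorem OrderInvariant.sum_words_head {R : Type*} [AddCommMonoid R] {F : List ℕ → R}
    (hF : OrderInvariant F) {A : Finset ℕ} {q : ℕ} (hq : q ∈ A) :
    (∑ w ∈ words A, if w.head? = some q then F w else 0) =
      ∑ w ∈ words (Finset.Icc 1 A.card), if w.head? = some (rankIn A q) then F w else 0 := by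
  rw [← image_rankIn, sum_words_image _ _ (rankIn_strictMonoOn A).injOn]
  refine Finset.sum_congr rfl fun w hw => ?_
  have h1 : F (w.map (rankIn A)) = F w := by
    refine hF _ _ ?_
    intro x hx y hy h
    exact rankIn_strictMonoOn A ((mem_of_mem_words hw _).1 hx) ((mem_of_mem_words hw _).1 hy) h
  rw [h1]
  refine if_congr ?_ rfl rfl
  cases w with
  | nil => simp
  | cons a w =>
    have ha : a ∈ A := (mem_of_mem_words hw _).1 (by simp)
    simp only [List.head?_cons, List.map_cons, Option.some.injEq]
    exact ⟨fun h => by rw [h], fun h => (rankIn_strictMonoOn A).injOn ha hq h⟩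

/-- The product formula for statistics on the two parts of a word cut after `m` letters. -/
theorem sum_words_mul_take_drop {R : Type*} [CommSemiring R] {F G : List ℕ → R}
    (hF : OrderInvariant F) (hG : OrderInvariant G) {n m : ℕ} (hm : m ≤ n) :
    ∑ w ∈ words (Finset.Icc 1 n), F (w.take m) * G (w.drop m) =
      (n.choose m : R) * ((∑ w ∈ words (Finset.Icc 1 m), F w) *
        ∑ w ∈ words (Finset.Icc 1 (n - m)), G w) := by
  rw [sum_words_take_drop _ _ (by simpa using hm) fun v w => F v * G w]
  have key : ∀ B ∈ (Finset.Icc 1 n).powersetCard m,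
      (∑ v ∈ words B, ∑ w ∈ words (Finset.Icc 1 n \ B), F v * G w) =
      (∑ w ∈ words (Finset.Icc 1 m), F w) * ∑ w ∈ words (Finset.Icc 1 (n - m)), G w := by
    intro B hB
    rw [Finset.mem_powersetCard] at hB
    have hc : (Finset.Icc 1 n \ B).card = n - m := by
      rw [Finset.card_sdiff_of_subset hB.1, hB.2]
      simp
    rw [← Finset.sum_mul_sum, hF.sum_words B, hG.sum_words, hB.2, hc]
  rw [Finset.sum_congr rfl key, Finset.sum_const, Finset.card_powersetCard, nsmul_eq_mul]
  simp

/-! ### Occurrences and clusters in a word -/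

/-- The first four letters of the word are in the same relative order as `2143`. -/
def Starts2143 : List ℕ → Prop
  | a :: b :: c :: d :: _ => b < a ∧ a < d ∧ d < c
  | _ => False

instance : DecidablePred Starts2143
  | a :: b :: c :: d :: _ => inferInstanceAs (Decidable (b < a ∧ a < d ∧ d < c))
  | [] => isFalse id
  | [_] => isFalse id
  | [_, _] => isFalse id
  | [_, _, _] => isFalse id

theorem starts2143_iff {w : List ℕ} : Starts2143 w ↔
    ∃ a b c d v, w = a :: b :: c :: d :: v ∧ b < a ∧ a < d ∧ d < c := by
  constructor
  · intro h
    match w, h with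
    | a :: b :: c :: d :: v, h => exact ⟨a, b, c, d, v, rfl, h⟩
  · rintro ⟨a, b, c, d, v, rfl, h⟩
    exact h

theorem Starts2143.four_le_length {w : List ℕ} (h : Starts2143 w) : 4 ≤ w.length := by
  obtain ⟨a, b, c, d, v, rfl, -⟩ := starts2143_iff.1 h
  simp

theorem starts2143_take_iff {w : List ℕ} {m : ℕ} :
    Starts2143 (w.take m) ↔ Starts2143 w ∧ 4 ≤ m := by
  constructor
  · intro h
    have hm := h.four_le_length
    rw [List.length_take] at hm
    obtain ⟨m, rfl⟩ : ∃ k, m = k + 4 := ⟨m - 4, by omega⟩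
    refine ⟨?_, by omega⟩
    match w, h with
    | a :: b :: c :: d :: v, h => exact h
  · rintro ⟨h, hm⟩
    obtain ⟨m, rfl⟩ : ∃ k, m = k + 4 := ⟨m - 4, by omega⟩
    obtain ⟨a, b, c, d, v, rfl, h⟩ := starts2143_iff.1 h
    exact h

theorem starts2143_map_iff {w : List ℕ} {g : ℕ → ℕ} (hg : StrictMonoOn g {x | x ∈ w}) :
    Starts2143 (w.map g) ↔ Starts2143 w := by
  match w with
  | a :: b :: c :: d :: v =>
    simp only [List.map_cons, Starts2143]
    rw [hg.lt_iff_lt (by simp) (by simp), hg.lt_iff_lt (by simp) (by simp),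
      hg.lt_iff_lt (by simp) (by simp)]
  | [] => rfl
  | [_] => rfl
  | [_, _] => rfl
  | [_, _, _] => rfl

/-- The number of occurrences of `2143` in a word. -/
def wordOccurrences : List ℕ → ℕ
  | [] => 0
  | a :: w => (if Starts2143 (a :: w) then 1 else 0) + wordOccurrences w

/-- The number of ways to mark `l` occurrences of `2143` in a word that make it an `l`-cluster. -/
def wordClusters : ℕ → List ℕ → ℕ
  | 0, w => if w.length = 1 then 1 else 0
  -- The next marked occurrence starts 2 or 3 places further on. After the last one, dropping 3 of
  -- its 4 letters leaves the one-letter 0-cluster, while dropping 2 leaves a word that is not a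
  -- 0-cluster.
  | l + 1, w => if Starts2143 w then wordClusters l (w.drop 2) + wordClusters l (w.drop 3) else 0

theorem orderInvariant_wordOccurrences : OrderInvariant wordOccurrences := by
  intro w g hg
  induction w with
  | nil => rfl
  | cons a w ih =>
    have h1 := starts2143_map_iff hg
    rw [List.map_cons] at h1 ⊢
    simp only [wordOccurrences]
    rw [if_congr h1 rfl rfl, ih (hg.mono fun x hx => List.mem_cons_of_mem a hx)]

theorem orderInvariant_wordClusters (l : ℕ) : OrderInvariant (wordClusters l) := by
  induction l with
  | zero =>
    intro w g _
    simp [wordClusters]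
  | succ l ih =>
    intro w g hg
    simp only [wordClusters, ← List.map_drop]
    rw [if_congr (starts2143_map_iff hg) rfl rfl, ih _ _ (hg.mono fun x hx => List.mem_of_mem_drop hx),
      ih _ _ (hg.mono fun x hx => List.mem_of_mem_drop hx)]

/-- Each marked occurrence uses up at least two letters and a 0-cluster still has one. This makes
the finite range in `clusterWeight` harmless. -/
theorem lt_length_of_wordClusters_ne_zero {l : ℕ} {w : List ℕ} (h : wordClusters l w ≠ 0) :
    l < w.length := by
  induction l generalizing w with
  | zero =>
    simp only [wordClusters] at h
    split_ifs at h with h1 <;> omega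
  | succ l ih =>
    simp only [wordClusters] at h
    split_ifs at h with h1
    · have := h1.four_le_length
      rcases Nat.eq_zero_or_pos (wordClusters l (w.drop 2)) with h2 | h2
      · have := ih (w := w.drop 3) (by omega)
        rw [List.length_drop] at this
        omega
      · have := ih (w := w.drop 2) (by omega)
        rw [List.length_drop] at this
        omega
    · exact absurd rfl h

/-! ### The cluster identity -/

/-- The clusters in a word, each weighted by `u` to the number of its marked occurrences. -/
noncomputable def clusterWeight {R : Type*} [CommRing R] (u : R) (w : List ℕ) : R :=
  ∑ l ∈ Finset.range w.length, (wordClusters l w : R) * u ^ l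

section weights

variable {R : Type*} [CommRing R] (u : R)

theorem clusterWeight_eq_sum {w : List ℕ} {N : ℕ} (hN : w.length ≤ N) :
    clusterWeight u w = ∑ l ∈ Finset.range N, (wordClusters l w : R) * u ^ l := by
  refine Finset.sum_subset (Finset.range_subset_range.2 hN) ?_
  intro l _ hl
  have : wordClusters l w = 0 := by
    by_contra h
    exact hl (Finset.mem_range.2 (lt_length_of_wordClusters_ne_zero h))
  simp [this]

/-- Splits off the 0-cluster, or else the first marked occurrence with its factor `u`. -/
theorem clusterWeight_eq (w : List ℕ) : clusterWeight u w = (if w.length = 1 then 1 else 0) +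
    u * (if Starts2143 w then clusterWeight u (w.drop 2) + clusterWeight u (w.drop 3) else 0) := by
  rw [clusterWeight_eq_sum u (Nat.le_succ w.length), Finset.sum_range_succ', add_comm]
  congr 1
  · simp [wordClusters]
  · split_ifs with h
    · rw [clusterWeight_eq_sum u (w := w.drop 2) (N := w.length) (by simp),
        clusterWeight_eq_sum u (w := w.drop 3) (N := w.length) (by simp),
        ← Finset.sum_add_distrib, Finset.mul_sum]
      refine Finset.sum_congr rfl fun l _ => ?_
      simp only [wordClusters, if_pos h]
      push_cast
      ring
    · simp [wordClusters, h]

theorem orderInvariant_clusterWeight : OrderInvariant (clusterWeight u) := by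
  intro w g hg
  simp [clusterWeight, orderInvariant_wordClusters _ w g hg]

/-- A word with weighted occurrences is a sequence of clusters. -/
theorem pow_wordOccurrences_eq_sum (w : List ℕ) (hw : w ≠ []) :
    (1 + u) ^ wordOccurrences w = ∑ m ∈ Finset.Icc 1 w.length,
      clusterWeight u (w.take m) * (1 + u) ^ wordOccurrences (w.drop m) := by
  induction hN : w.length using Nat.strong_induction_on generalizing w with
  | _ N ih =>
  subst hN
  obtain ⟨a, w, rfl⟩ := List.exists_cons_of_ne_nil hw
  by_cases h : Starts2143 (a :: w)
  · obtain ⟨_, b, c, d, v, h', h1, h2, h3⟩ := starts2143_iff.1 h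
    obtain ⟨rfl, rfl⟩ := List.cons.inj h'
    have hd2 := ih (c :: d :: v).length (by simp) (c :: d :: v) (by simp) rfl
    have hd3 := ih (d :: v).length (by simp) (d :: v) (by simp) rfl
    have hone : ∀ x : ℕ, clusterWeight u [x] = 1 := by
      intro x
      rw [clusterWeight_eq]
      simp [Starts2143]
    have hterm : ∀ m, clusterWeight u ((a :: b :: c :: d :: v).take (m + 4)) =
        u * (clusterWeight u ((c :: d :: v).take (m + 2)) +
          clusterWeight u ((d :: v).take (m + 1))) := by
      intro m
      rw [clusterWeight_eq, if_pos (starts2143_take_iff.2 ⟨h, by omega⟩)]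
      simp
    have hnil : ∀ x y : ℕ, clusterWeight u [x, y] = 0 := by
      intro x y
      rw [clusterWeight_eq]
      simp [Starts2143]
    have hnil3 : ∀ x y z : ℕ, clusterWeight u [x, y, z] = 0 := by
      intro x y z
      rw [clusterWeight_eq]
      simp [Starts2143]
    have hs : ∀ (N : ℕ) (f : ℕ → R), ∑ m ∈ Finset.Icc 1 N, f m =
        ∑ m ∈ Finset.range N, f (m + 1) := by
      intro N f
      rw [Finset.range_eq_Ico, Finset.sum_Ico_add' f 0 N 1]
      rfl
    rw [hs] at hd2 hd3 ⊢
    simp only [List.length_cons, Finset.sum_range_succ'] at hd2 hd3 ⊢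
    simp only [Nat.reduceAdd, zero_add, add_assoc, hterm] at hd2 hd3 ⊢
    simp only [List.take_succ_cons, List.drop_succ_cons, List.take_zero, List.drop_zero, hone, hnil,
      hnil3, zero_mul, one_mul, zero_add, mul_add, add_mul, Finset.sum_add_distrib,
      mul_assoc, ← Finset.mul_sum] at hd2 hd3 ⊢
    -- An occurrence one place on would need `c < b`, against `b < a < d < c`.
    have ho : ¬ Starts2143 (b :: c :: d :: v) := by
      intro h4
      obtain ⟨_, _, _, _, _, h5, h6, h7, h8⟩ := starts2143_iff.1 h4
      simp only [List.cons.injEq] at h5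
      omega
    have e1 : wordOccurrences (b :: c :: d :: v) = wordOccurrences (c :: d :: v) := by
      rw [wordOccurrences, if_neg ho, zero_add]
    have e0 : wordOccurrences (a :: b :: c :: d :: v) = 1 + wordOccurrences (c :: d :: v) := by
      rw [wordOccurrences, if_pos h, e1]
    rw [e0, e1, pow_add, pow_one]
    -- Write `P`, `Q` for the powers belonging to `c :: d :: v` and `d :: v`. The one-letter first
    -- cluster contributes `P`. The longer ones contribute `u * (P - Q)` at distance 2, where the
    -- one-letter cluster `[c]` is missing, and `u * Q` at distance 3. The total is `(1 + u) * P`.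
    linear_combination u * hd2 + u * hd3
  -- A cluster longer than one letter starts with an occurrence, so here only the one-letter prefix
  -- counts.
  · rw [Finset.sum_eq_single 1]
    · rw [clusterWeight_eq, if_neg fun h' => h (starts2143_take_iff.1 h').1]
      simp [wordOccurrences, h]
    · intro m hm hm1
      rw [Finset.mem_Icc] at hm
      rw [clusterWeight_eq, if_neg fun h' => h (starts2143_take_iff.1 h').1, List.length_take,
        if_neg (by omega)]
      simp
    · simp

/-- The recurrence between the totals of the two weights over all words of length `n`. -/
theorem sum_words_pow_wordOccurrences {n : ℕ} (hn : n ≠ 0) :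
    ∑ w ∈ words (Finset.Icc 1 n), (1 + u) ^ wordOccurrences w =
      ∑ m ∈ Finset.Icc 1 n, (n.choose m : R) * ((∑ w ∈ words (Finset.Icc 1 m), clusterWeight u w) *
        ∑ w ∈ words (Finset.Icc 1 (n - m)), (1 + u) ^ wordOccurrences w) := by
  have h1 : ∀ w ∈ words (Finset.Icc 1 n), (1 + u) ^ wordOccurrences w = ∑ m ∈ Finset.Icc 1 n,
      clusterWeight u (w.take m) * (1 + u) ^ wordOccurrences (w.drop m) := by
    intro w hw
    have hl : w.length = n := by simpa using length_of_mem_words hw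
    rw [pow_wordOccurrences_eq_sum u w (by rintro rfl; simp at hl; omega), hl]
  rw [Finset.sum_congr rfl h1, Finset.sum_comm]
  refine Finset.sum_congr rfl fun m hm => ?_
  refine sum_words_mul_take_drop (G := fun w => (1 + u) ^ wordOccurrences w)
    (orderInvariant_clusterWeight u) ?_ (Finset.mem_Icc.1 hm).2
  intro w g hg
  simp only [orderInvariant_wordOccurrences w g hg]

end weights

/-! ### Permutations as words -/

/-- The entries `1, …, n` of a permutation of length `n`, written as a word. -/
def permWord {n : ℕ} (σ : Perm (Fin n)) : List ℕ := List.ofFn fun i => (σ i : ℕ) + 1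

theorem length_permWord {n : ℕ} (σ : Perm (Fin n)) : (permWord σ).length = n := by
  simp [permWord]

theorem sum_permWord {R : Type*} [AddCommMonoid R] (n : ℕ) (F : List ℕ → R) :
    ∑ σ : Perm (Fin n), F (permWord σ) = ∑ w ∈ words (Finset.Icc 1 n), F w := by
  refine Finset.sum_bij (fun σ _ => permWord σ) ?_ ?_ ?_ ?_
  · intro σ _
    refine mem_words.2 ⟨?_, ?_⟩
    · rw [permWord, List.nodup_ofFn]
      intro i j h
      exact σ.injective (Fin.ext (by simpa using h))
    · ext x
      simp only [permWord, List.mem_toFinset, List.mem_ofFn, Finset.mem_Icc]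
      constructor
      · rintro ⟨i, rfl⟩
        omega
      · intro hx
        refine ⟨σ.symm ⟨x - 1, by omega⟩, ?_⟩
        simp only [Equiv.apply_symm_apply]
        omega
  · intro σ _ ρ _ h
    have := List.ofFn_injective h
    ext i
    have := congrFun this i
    simpa using this
  · intro w hw
    have hl : w.length = n := by simpa using length_of_mem_words hw
    obtain ⟨hn, -⟩ := mem_words.1 hw
    have hmem : ∀ i : Fin n, 1 ≤ w[i] ∧ w[i] ≤ n := by
      intro i
      exact Finset.mem_Icc.1 ((mem_of_mem_words hw _).1 (List.getElem_mem _))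
    have hinj : Function.Injective fun i : Fin n => (⟨w[i] - 1, by
        have := hmem i
        omega⟩ : Fin n) := by
      intro i j h
      have h' := congrArg Fin.val h
      simp only at h'
      have hi := hmem i
      have hj := hmem j
      have h2 : w[(i : ℕ)] = w[(j : ℕ)] := by
        simp only [Fin.getElem_fin] at hi hj h'
        omega
      exact Fin.ext ((hn.getElem_inj_iff).1 h2)
    refine ⟨Equiv.ofBijective _ (Finite.injective_iff_bijective.1 hinj), Finset.mem_univ _, ?_⟩
    refine List.ext_getElem (by simp [permWord, hl]) ?_
    intro i h1 h2
    have := hmem ⟨i, by omega⟩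
    simp only [permWord, List.getElem_ofFn, Equiv.ofBijective_apply, Fin.getElem_fin] at this ⊢
    omega
  · intro σ _
    rfl

theorem starts2143_drop_iff {w : List ℕ} {i : ℕ} : Starts2143 (w.drop i) ↔
    ∃ h : i + 4 ≤ w.length, w[i + 1] < w[i] ∧ w[i] < w[i + 3] ∧ w[i + 3] < w[i + 2] := by
  by_cases h : i + 4 ≤ w.length
  · rw [List.drop_eq_getElem_cons (by omega), List.drop_eq_getElem_cons (by omega),
      List.drop_eq_getElem_cons (by omega), List.drop_eq_getElem_cons (by omega)]
    simp [Starts2143, h]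
  · constructor
    · intro h'
      have := h'.four_le_length
      rw [List.length_drop] at this
      omega
    · rintro ⟨h', -⟩
      exact absurd h' h

theorem lt_iff_perm2143_lt (f : Fin 4 → ℕ) :
    (∀ a b, f a < f b ↔ perm2143 a < perm2143 b) ↔ f 1 < f 0 ∧ f 0 < f 3 ∧ f 3 < f 2 := by
  constructor
  · intro h
    exact ⟨(h 1 0).2 (by decide), (h 0 3).2 (by decide), (h 3 2).2 (by decide)⟩
  · rintro ⟨h1, h2, h3⟩ a b
    fin_cases a <;> fin_cases b <;> simp [perm2143] <;> omega

theorem isOccurrence_perm2143_iff {n : ℕ} (σ : Perm (Fin n)) (i : Fin n) :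
    IsOccurrence perm2143 σ i ↔ Starts2143 ((permWord σ).drop i) := by
  rw [starts2143_drop_iff]
  unfold IsOccurrence
  simp only [length_permWord]
  refine exists_congr fun h => ?_
  refine Iff.trans ?_ ((lt_iff_perm2143_lt fun a => (σ ⟨(i : ℕ) + a, by omega⟩ : ℕ)).trans ?_)
  · rfl
  · simp [permWord]

theorem wordOccurrences_eq_card (w : List ℕ) :
    wordOccurrences w = ∑ i ∈ Finset.range w.length, if Starts2143 (w.drop i) then 1 else 0 := by
  induction w with
  | nil => rfl
  | cons a w ih =>
    rw [List.length_cons, Finset.sum_range_succ', wordOccurrences, ih, add_comm]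
    rfl

theorem occurrenceCount_perm2143 {n : ℕ} (σ : Perm (Fin n)) :
    occurrenceCount perm2143 σ = wordOccurrences (permWord σ) := by
  classical
  rw [wordOccurrences_eq_card, length_permWord, occurrenceCount, Set.ncard_eq_toFinset_card',
    ← Fin.sum_univ_eq_sum_range fun i => if Starts2143 ((permWord σ).drop i) then 1 else 0,
    ← Finset.card_filter]
  congr 1
  ext i
  simp [isOccurrence_perm2143_iff]

/-! ### Marked positions and the recursive cluster count -/

/-- The positions `i` mark overlapping occurrences of `2143` that cover the word `w`. -/
structure IsWordCluster {l : ℕ} (w : List ℕ) (i : Fin l → ℕ) : Prop where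
  occ : ∀ k, Starts2143 (w.drop (i k))
  linked : ∀ (k : ℕ) (hk : k + 1 < l),
    i ⟨k, by omega⟩ < i ⟨k + 1, hk⟩ ∧ i ⟨k + 1, hk⟩ < i ⟨k, by omega⟩ + 4
  first : ∀ hl : 0 < l, i ⟨0, hl⟩ = 0
  last : ∀ hl : 0 < l, w.length = i ⟨l - 1, by omega⟩ + 4
  zero : l = 0 → w.length = 1

theorem IsWordCluster.lt_length {l : ℕ} {w : List ℕ} {i : Fin l → ℕ} (h : IsWordCluster w i)
    (k : Fin l) : i k < w.length := by
  have := (h.occ k).four_le_length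
  rw [List.length_drop] at this
  omega

theorem finite_setOf_isWordCluster (l : ℕ) (w : List ℕ) :
    {i : Fin l → ℕ | IsWordCluster w i}.Finite :=
  (Set.finite_Iic fun _ => w.length).subset fun _ h k => (IsWordCluster.lt_length h k).le

/-- The cluster with one more marked occurrence, `d` places before the others. -/
def consCluster {l : ℕ} (d : ℕ) (i : Fin l → ℕ) : Fin (l + 1) → ℕ := Fin.cons 0 fun k => i k + d

theorem consCluster_injective {l : ℕ} (d : ℕ) :
    Function.Injective (consCluster d : (Fin l → ℕ) → Fin (l + 1) → ℕ) := by
  intro i j h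
  funext k
  have : i k + d = j k + d := congrFun h k.succ
  omega

theorem isWordCluster_consCluster {l d : ℕ} {w : List ℕ} {i : Fin l → ℕ} (hd : d = 2 ∨ d = 3)
    (hw : Starts2143 w) (h : IsWordCluster (w.drop d) i) :
    IsWordCluster w (consCluster d i) where
  occ k := by
    refine Fin.cases hw (fun k => ?_) k
    have := h.occ k
    rw [List.drop_drop, add_comm] at this
    exact this
  linked k hk := by
    cases k with
    | zero =>
      change 0 < i ⟨0, _⟩ + d ∧ i ⟨0, _⟩ + d < 0 + 4
      rw [h.first]
      omega
    | succ k =>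
      have := h.linked k (by omega)
      change i ⟨k, _⟩ + d < i ⟨k + 1, _⟩ + d ∧ i ⟨k + 1, _⟩ + d < i ⟨k, _⟩ + d + 4
      omega
  first _ := rfl
  last _ := by
    have h4 := hw.four_le_length
    cases l with
    | zero =>
      -- Only `d = 3` is possible here: `d = 2` would give `w` length 3, too short for an
      -- occurrence.
      have := h.zero rfl
      rw [List.length_drop] at this
      change w.length = 0 + 4
      omega
    | succ l =>
      have := h.last (Nat.succ_pos l)
      rw [List.length_drop] at this
      change w.length = i ⟨l, _⟩ + d + 4
      change w.length - d = i ⟨l, _⟩ + 4 at this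
      omega
  zero h0 := absurd h0 (Nat.succ_ne_zero l)

theorem not_starts2143_tail {w : List ℕ} (h : Starts2143 w) : ¬ Starts2143 (w.drop 1) := by
  obtain ⟨a, b, c, d, v, rfl, h1, h2, h3⟩ := starts2143_iff.1 h
  intro h4
  obtain ⟨_, _, _, _, _, h5, h6, h7, h8⟩ := starts2143_iff.1 h4
  simp only [List.drop_succ_cons, List.drop_zero, List.cons.injEq] at h5
  omega

/-- Here `d` is the position of the second marked occurrence, which cannot be 1. A single occurrence
takes `d = 3`, leaving the one-letter 0-cluster. -/
theorem IsWordCluster.exists_consCluster {l : ℕ} {w : List ℕ} {i : Fin (l + 1) → ℕ}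
    (h : IsWordCluster w i) : ∃ d j, (d = 2 ∨ d = 3) ∧ IsWordCluster (w.drop d) j ∧
      consCluster d j = i := by
  have hi0 : i 0 = 0 := h.first (Nat.succ_pos l)
  have hw : Starts2143 w := by
    have := h.occ 0
    rwa [hi0] at this
  cases l with
  | zero =>
    have hl : w.length = i 0 + 4 := h.last (Nat.succ_pos 0)
    refine ⟨3, Fin.elim0, Or.inr rfl, ⟨fun k => k.elim0, fun k hk => by omega, fun h => by omega,
      fun h => by omega, fun _ => ?_⟩, ?_⟩
    · rw [List.length_drop]
      omega
    · funext k
      exact Fin.cases hi0.symm (fun k => k.elim0) k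
  | succ l =>
    have h01 : i 0 < i 1 ∧ i 1 < i 0 + 4 := h.linked 0 (by omega)
    have hd : i 1 = 2 ∨ i 1 = 3 := by
      have : i 1 ≠ 1 := by
        intro h1
        have := h.occ 1
        rw [h1] at this
        exact not_starts2143_tail hw this
      omega
    have hle : ∀ (k : ℕ) (hk : k < l + 1), i 1 ≤ i (Fin.succ ⟨k, hk⟩) := by
      intro k
      induction k with
      | zero => exact fun _ => le_rfl
      | succ k ih =>
        intro hk
        have h1 := ih (by omega)
        have h2 := (h.linked (k + 1) (by omega)).1
        exact h1.trans h2.le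
    have hlen : w.length = i (Fin.succ ⟨l, by omega⟩) + 4 := h.last (Nat.succ_pos _)
    refine ⟨i 1, fun k => i k.succ - i 1, hd, ⟨fun k => ?_, fun k hk => ?_, fun _ => ?_, fun _ => ?_,
      fun h => by omega⟩, ?_⟩
    · have h1 := hle k k.isLt
      rw [List.drop_drop, Nat.add_sub_cancel' h1]
      exact h.occ k.succ
    · have h1 := hle k (by omega)
      have h2 := hle (k + 1) hk
      have h3 : i (Fin.succ ⟨k, by omega⟩) < i (Fin.succ ⟨k + 1, hk⟩) ∧
        i (Fin.succ ⟨k + 1, hk⟩) < i (Fin.succ ⟨k, by omega⟩) + 4 := h.linked (k + 1) (by omega)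
      omega
    · exact Nat.sub_self _
    · have h1 := hle l (by omega)
      rw [List.length_drop, hlen]
      change _ = i (Fin.succ ⟨l, _⟩) - i 1 + 4
      omega
    · funext k
      refine Fin.cases hi0.symm (fun k => ?_) k
      exact Nat.sub_add_cancel (hle k k.isLt)

theorem ncard_isWordCluster (l : ℕ) (w : List ℕ) :
    {i : Fin l → ℕ | IsWordCluster w i}.ncard = wordClusters l w := by
  classical
  induction l generalizing w with
  | zero =>
    rw [wordClusters]
    split_ifs with h
    · rw [Set.ncard_eq_one]
      refine ⟨Fin.elim0, Set.eq_singleton_iff_unique_mem.2 ⟨?_, fun _ _ => Subsingleton.elim _ _⟩⟩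
      exact ⟨fun k => k.elim0, fun k hk => by omega, fun h => by omega, fun h => by omega,
        fun _ => h⟩
    · rw [Set.ncard_eq_zero (finite_setOf_isWordCluster 0 w), Set.eq_empty_iff_forall_notMem]
      exact fun i hi => h (IsWordCluster.zero hi rfl)
  | succ l ih =>
    rw [wordClusters]
    split_ifs with hw
    · have hu : {i : Fin (l + 1) → ℕ | IsWordCluster w i} =
          consCluster 2 '' {i : Fin l → ℕ | IsWordCluster (w.drop 2) i} ∪
          consCluster 3 '' {i : Fin l → ℕ | IsWordCluster (w.drop 3) i} := by
        ext i
        constructor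
        · intro hi
          obtain ⟨d, j, rfl | rfl, hj, rfl⟩ := IsWordCluster.exists_consCluster hi
          · exact Or.inl ⟨j, hj, rfl⟩
          · exact Or.inr ⟨j, hj, rfl⟩
        · rintro (⟨j, hj, rfl⟩ | ⟨j, hj, rfl⟩)
          · exact isWordCluster_consCluster (Or.inl rfl) hw hj
          · exact isWordCluster_consCluster (Or.inr rfl) hw hj
      rw [hu, Set.ncard_union_eq _ ((finite_setOf_isWordCluster _ _).image _)
        ((finite_setOf_isWordCluster _ _).image _),
        Set.ncard_image_of_injective _ (consCluster_injective 2),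
        Set.ncard_image_of_injective _ (consCluster_injective 3), ih, ih]
      -- The distance `d` can be recovered: from the length of `w` if only one occurrence is marked,
      -- otherwise from the second marked position.
      rw [Set.disjoint_left]
      rintro _ ⟨i, hi, rfl⟩ ⟨j, hj, hij⟩
      cases l with
      | zero =>
        have h2 := IsWordCluster.zero hi rfl
        have h3 := IsWordCluster.zero hj rfl
        have := hw.four_le_length
        simp only [List.length_drop] at h2 h3
        omega
      | succ l =>
        have h1 : j 0 + 3 = i 0 + 2 := congrFun hij 1
        have h2 : i 0 = 0 := IsWordCluster.first hi (Nat.succ_pos l)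
        have h3 : j 0 = 0 := IsWordCluster.first hj (Nat.succ_pos l)
        omega
    · rw [Set.ncard_eq_zero (finite_setOf_isWordCluster _ w), Set.eq_empty_iff_forall_notMem]
      intro i hi
      have h1 := IsWordCluster.occ hi 0
      have h2 : i 0 = 0 := IsWordCluster.first hi (Nat.succ_pos l)
      rw [h2] at h1
      exact hw h1

theorem isCluster_perm2143_iff {n l : ℕ} (σ : Perm (Fin n)) (i : Fin l → Fin n) :
    IsCluster perm2143 σ i ↔ IsWordCluster (permWord σ) fun k => (i k : ℕ) := by
  constructor
  · intro h
    refine ⟨fun k => (isOccurrence_perm2143_iff σ _).1 (h.occ k), h.linked, h.first, ?_, ?_⟩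
    · rw [length_permWord]
      exact h.last
    · rw [length_permWord]
      exact h.zero
  · intro h
    refine ⟨fun k => (isOccurrence_perm2143_iff σ _).2 (h.occ k), h.linked, h.first, ?_, ?_⟩
    · have := h.last
      rwa [length_permWord] at this
    · have := h.zero
      rwa [length_permWord] at this

theorem ncard_isCluster_perm2143 {n l : ℕ} (σ : Perm (Fin n)) :
    {i : Fin l → Fin n | IsCluster perm2143 σ i}.ncard = wordClusters l (permWord σ) := by
  rw [← ncard_isWordCluster]
  have hinj : Function.Injective fun (i : Fin l → Fin n) (k : Fin l) => (i k : ℕ) := by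
    intro i j h
    funext k
    exact Fin.ext (congrFun h k)
  rw [← Set.ncard_image_of_injective _ hinj]
  congr 1
  ext i
  constructor
  · rintro ⟨j, hj, rfl⟩
    exact (isCluster_perm2143_iff σ j).1 hj
  · intro hi
    have hlt : ∀ k, i k < n := by
      intro k
      have := IsWordCluster.lt_length hi k
      rwa [length_permWord] at this
    exact ⟨fun k => ⟨i k, hlt k⟩, (isCluster_perm2143_iff σ _).2 hi, rfl⟩

theorem ncard_setOf_prod {α β : Type*} [Fintype α] [Fintype β] (P : α → β → Prop) :
    {x : α × β | P x.1 x.2}.ncard = ∑ a, {b | P a b}.ncard := by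
  classical
  simp_rw [Set.ncard_eq_toFinset_card', Set.toFinset_ofPred, Finset.card_filter]
  rw [Fintype.sum_prod_type]

/-! ### Cluster numbers as sums over words, and the generating function -/

theorem clusterCount_perm2143 (n l : ℕ) :
    clusterCount perm2143 n l = ∑ w ∈ words (Finset.Icc 1 n), wordClusters l w := by
  rw [clusterCount, ncard_setOf_prod fun σ i => IsCluster perm2143 σ i, ← sum_permWord]
  exact Finset.sum_congr rfl fun σ _ => ncard_isCluster_perm2143 σ

theorem clusterCountFirst_perm2143 (n l p : ℕ) :
    clusterCountFirst perm2143 n l p =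
      ∑ w ∈ words (Finset.Icc 1 n), if w.head? = some p then wordClusters l w else 0 := by
  rw [clusterCountFirst, ncard_setOf_prod fun (σ : Perm (Fin n)) (i : Fin l → Fin n) =>
    IsCluster perm2143 σ i ∧ ∃ h : 0 < n, (σ ⟨0, h⟩ : ℕ) + 1 = p, ← sum_permWord]
  refine Finset.sum_congr rfl fun σ _ => ?_
  have hh : (permWord σ).head? = some p ↔ ∃ h : 0 < n, (σ ⟨0, h⟩ : ℕ) + 1 = p := by
    cases n with
    | zero => simp [permWord]
    | succ n => simp [permWord, List.ofFn_succ]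
  rw [← ncard_isCluster_perm2143, if_congr hh rfl rfl]
  split_ifs with h
  · simp only [h, and_true]
  · simp only [h, and_false]
    exact Set.ncard_empty _

theorem coeff_occurrenceGF_perm2143 (n : ℕ) :
    PowerSeries.coeff n (occurrenceGF perm2143) =
      C ((n.factorial : ℚ)⁻¹) * ∑ w ∈ words (Finset.Icc 1 n), X ^ wordOccurrences w := by
  classical
  have hp : ∀ k, permCount perm2143 n k =
      ∑ σ : Perm (Fin n), if wordOccurrences (permWord σ) = k then 1 else 0 := by
    intro k
    simp only [permCount, occurrenceCount_perm2143]
    rw [Set.ncard_eq_toFinset_card', Set.toFinset_ofPred, Finset.card_filter]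
  rw [occurrenceGF, PowerSeries.coeff_mk, ← sum_permWord, Finset.mul_sum]
  simp_rw [hp]
  push_cast
  simp_rw [Finset.sum_div, map_sum, Finset.sum_mul]
  rw [Finset.sum_comm]
  refine Finset.sum_congr rfl fun σ _ => ?_
  have hle : wordOccurrences (permWord σ) ≤ n := by
    rw [wordOccurrences_eq_card, ← Finset.card_filter]
    refine (Finset.card_filter_le _ _).trans ?_
    simp [length_permWord]
  rw [Finset.sum_eq_single (wordOccurrences (permWord σ))]
  · simp
  · intro k _ hk
    simp [hk.symm]
  · intro h
    exact absurd (Finset.mem_range.2 (by omega)) h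

/-- The summand `X` of the series is the one-letter 0-cluster. For `n ≥ 2` there are no 0-clusters,
so starting at `l = 1` loses nothing. -/
theorem coeff_clusterGF_perm2143 (n : ℕ) :
    PowerSeries.coeff n (PowerSeries.X + clusterGFShifted perm2143) =
      C ((n.factorial : ℚ)⁻¹) * ∑ w ∈ words (Finset.Icc 1 n), clusterWeight (X - 1) w := by
  have hw : ∑ w ∈ words (Finset.Icc 1 n), clusterWeight (X - 1 : ℚ[X]) w =
      ∑ l ∈ Finset.range (n + 1), (clusterCount perm2143 n l : ℚ[X]) * (X - 1) ^ l := by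
    simp_rw [clusterCount_perm2143]
    push_cast
    simp_rw [Finset.sum_mul]
    rw [Finset.sum_comm]
    refine Finset.sum_congr rfl fun w hw => clusterWeight_eq_sum _ ?_
    have := length_of_mem_words hw
    simp at this
    omega
  have hone : ∀ w : List ℕ, w.length ≤ 1 → clusterWeight (X - 1 : ℚ[X]) w = w.length := by
    intro w h
    match w with
    | [] => simp [clusterWeight]
    | [a] => simp [clusterWeight, wordClusters]
  have hsmall : n ≤ 1 → ∑ w ∈ words (Finset.Icc 1 n), clusterWeight (X - 1 : ℚ[X]) w =
      n.factorial * n := by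
    intro hn
    rw [← sum_permWord, Finset.sum_congr rfl fun σ _ => hone (permWord σ)
      (by rw [length_permWord]; exact hn)]
    simp [length_permWord, Fintype.card_perm]
  rw [map_add, PowerSeries.coeff_X, clusterGFShifted, PowerSeries.coeff_mk]
  rcases lt_or_ge n 2 with hn | hn
  · rw [hsmall (by omega), if_neg (not_le.2 hn)]
    rcases (by omega : n = 0 ∨ n = 1) with rfl | rfl <;> simp
  · have h0 : clusterCount perm2143 n 0 = 0 := by
      rw [clusterCount_perm2143]
      refine Finset.sum_eq_zero fun w hw => ?_
      have := length_of_mem_words hw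
      simp only [Nat.card_Icc, Nat.add_sub_cancel] at this
      rw [wordClusters, if_neg (by omega)]
    rw [if_neg (by omega), if_pos hn, hw, zero_add, Finset.mul_sum,
      ← Finset.sum_subset (s₁ := Finset.Icc 1 n) (s₂ := Finset.range (n + 1))]
    · refine Finset.sum_congr rfl fun l _ => ?_
      rw [div_eq_mul_inv, C_mul, ← mul_assoc, mul_comm (C _) (C _)]
      simp
    · intro l hl
      rw [Finset.mem_Icc] at hl
      exact Finset.mem_range.2 (by omega)
    · intro l hl hl'
      rw [Finset.mem_range] at hl
      rw [Finset.mem_Icc] at hl'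
      have : l = 0 := by omega
      rw [this, h0]
      simp

theorem occurrenceGF_perm2143_mul :
    occurrenceGF perm2143 * (1 - PowerSeries.X - clusterGFShifted perm2143) = 1 := by
  rw [sub_sub, mul_sub, mul_one, sub_eq_iff_eq_add]
  ext1 n
  -- The swap makes the first index of the antidiagonal the length of the leading cluster.
  rw [map_add, PowerSeries.coeff_mul, PowerSeries.coeff_one, ← Finset.Nat.sum_antidiagonal_swap]
  simp_rw [coeff_clusterGF_perm2143, coeff_occurrenceGF_perm2143]
  rcases eq_or_ne n 0 with rfl | hn
  · simp [words_empty, wordOccurrences, clusterWeight]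
  · have hX : ∀ k : ℕ, (X : ℚ[X]) ^ k = (1 + (X - 1)) ^ k := fun k => by
      rw [add_sub_cancel]
    simp_rw [hX, Prod.fst_swap, Prod.snd_swap]
    rw [if_neg hn, zero_add, Finset.Nat.sum_antidiagonal_eq_sum_range_succ_mk,
      sum_words_pow_wordOccurrences _ hn, Finset.mul_sum,
      ← Finset.sum_subset (s₁ := Finset.Icc 1 n) (s₂ := Finset.range (n + 1))]
    · refine Finset.sum_congr rfl fun m hm => ?_
      rw [Finset.mem_Icc] at hm
      -- The binomial coefficient for choosing the letters of the first cluster turns the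
      -- convolution into a product of exponential series.
      have hc : C ((n.factorial : ℚ)⁻¹) * ((n.choose m : ℕ) : ℚ[X]) =
          C (((n - m).factorial : ℚ)⁻¹) * C ((m.factorial : ℚ)⁻¹) := by
        rw [← map_natCast C, ← C_mul, ← C_mul, Nat.cast_choose ℚ hm.2]
        congr 1
        have := n.factorial_ne_zero
        field_simp
      rw [← mul_assoc, hc]
      ring
    · intro m hm
      rw [Finset.mem_Icc] at hm
      exact Finset.mem_range.2 (by omega)
    · intro m hm hm'
      rw [Finset.mem_range] at hm
      rw [Finset.mem_Icc] at hm'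
      have : m = 0 := by omega
      subst this
      simp [words_empty, clusterWeight]

/-! ### Runs of occurrences at distance 2 -/

/-- The word has occurrences of `2143` at its first `k` odd places. -/
def IsRun : ℕ → List ℕ → Prop
  | 0, _ => True
  | k + 1, w => Starts2143 w ∧ IsRun k (w.drop 2)

instance decidableIsRun : ∀ k w, Decidable (IsRun k w)
  | 0, _ => isTrue trivial
  | k + 1, w => @instDecidableAnd _ _ _ (decidableIsRun k (w.drop 2))

theorem IsRun.le_length {k : ℕ} {w : List ℕ} (h : IsRun (k + 1) w) : 2 * k + 4 ≤ w.length := by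
  induction k generalizing w with
  | zero => exact h.1.four_le_length
  | succ k ih =>
    have := ih h.2
    rw [List.length_drop] at this
    omega

theorem isRun_take {k m : ℕ} {w : List ℕ} (hm : 2 * k + 2 ≤ m) :
    IsRun k (w.take m) ↔ IsRun k w := by
  induction k generalizing w m with
  | zero => rfl
  | succ k ih =>
    rw [IsRun, IsRun, starts2143_take_iff, List.drop_take, ih (by omega)]
    constructor
    · exact fun h => ⟨h.1.1, h.2⟩
    · exact fun h => ⟨⟨h.1, by omega⟩, h.2⟩

/-- The clusters in a word, sorted by the number of overlaps in two letters they begin with. -/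
theorem wordClusters_eq_sum_isRun (l : ℕ) (w : List ℕ) (hw : 2 ≤ w.length) :
    wordClusters l w = ∑ k ∈ Finset.range l,
      if IsRun (k + 1) w then wordClusters (l - (k + 1)) (w.drop (2 * k + 3)) else 0 := by
  induction l generalizing w with
  | zero =>
    rw [wordClusters, if_neg (by omega)]
    rfl
  | succ l ih =>
    rw [wordClusters, Finset.sum_range_succ']
    split_ifs with h h' h'
    · have h4 := h.four_le_length
      rw [ih (w.drop 2) (by rw [List.length_drop]; omega)]
      refine congrArg₂ _ (Finset.sum_congr rfl fun k _ => ?_) rfl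
      rw [List.drop_drop, Nat.add_sub_add_right]
      refine if_congr ?_ (by congr 2; omega) rfl
      rw [IsRun.eq_def (k + 1 + 1)]
      exact ⟨fun hk => ⟨h, hk⟩, fun hk => hk.2⟩
    · exact absurd ⟨h, trivial⟩ h'
    · exact absurd h'.1 h
    · rw [Finset.sum_eq_zero fun k _ => if_neg fun hk => h hk.1]

/-- Swap the first two letters, the next two letters, and so on. -/
def swapPairs : List ℕ → List ℕ
  | a :: b :: w => b :: a :: swapPairs w
  | w => w

theorem swapPairs_swapPairs (w : List ℕ) : swapPairs (swapPairs w) = w := by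
  induction w using swapPairs.induct with
  | case1 a b w ih => simp [swapPairs, ih]
  | case2 w h =>
    match w with
    | [] => rfl
    | [_] => rfl
    | a :: b :: w => exact absurd rfl (h a b w)

theorem perm_swapPairs (w : List ℕ) : (swapPairs w).Perm w := by
  induction w using swapPairs.induct with
  | case1 a b w ih => exact (List.Perm.swap a b _).trans ((ih.cons b).cons a)
  | case2 w h =>
    match w with
    | [] => exact List.Perm.refl _
    | [_] => exact List.Perm.refl _
    | a :: b :: w => exact absurd rfl (h a b w)

theorem swapPairs_append {k : ℕ} {v : List ℕ} (hv : v.length = 2 * k) (w : List ℕ) :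
    swapPairs (v ++ w) = swapPairs v ++ swapPairs w := by
  induction k generalizing v with
  | zero =>
    rw [List.eq_nil_of_length_eq_zero hv]
    rfl
  | succ k ih =>
    match v, hv with
    | a :: b :: v, hv =>
      simp only [List.length_cons] at hv
      simp [swapPairs, ih (v := v) (by omega)]

/-- An occurrence on `a b c d` says exactly that `b, a, d, c` increases. Consecutive occurrences
share a pair, so the inequalities join into one chain. -/
theorem isRun_iff_isChain {k : ℕ} {w : List ℕ} (hw : w.length = 2 * k + 4) :
    IsRun (k + 1) w ↔ (swapPairs w).IsChain (· < ·) := by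
  induction k generalizing w with
  | zero =>
    match w, hw with
    | [a, b, c, d], _ => simp [IsRun, Starts2143, swapPairs]
  | succ k ih =>
    match w, hw with
    | a :: b :: c :: d :: w, hw =>
      simp only [List.length_cons] at hw
      have h1 := ih (w := c :: d :: w) (by simp only [List.length_cons]; omega)
      rw [IsRun, List.drop_succ_cons, List.drop_succ_cons, List.drop_zero, h1]
      simp only [swapPairs, List.isChain_cons_cons, Starts2143]
      tauto

/-- The last letter `q` of the run is kept apart because the rest of the cluster starts with it. Its
partner `d` comes before it and is larger. -/
theorem isRun_append_singleton_iff {k q : ℕ} {v : List ℕ} (hv : v.length = 2 * k + 3) :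
    IsRun (k + 1) (v ++ [q]) ↔ ∃ p a u d, v = p :: a :: (u ++ [d]) ∧ u.length = 2 * k ∧
      (a :: p :: (swapPairs u ++ [q, d])).Pairwise (· < ·) := by
  rw [isRun_iff_isChain (by simp [hv]), List.isChain_iff_pairwise]
  constructor
  · intro h
    match v, hv with
    | p :: a :: v, hv =>
      simp only [List.length_cons] at hv
      obtain rfl | ⟨u, d, rfl⟩ := List.eq_nil_or_concat' v
      · simp at hv
      · have hu : u.length = 2 * k := by simpa using hv
        exact ⟨p, a, u, d, rfl, hu, by simpa [swapPairs, swapPairs_append hu] using h⟩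
  · rintro ⟨p, a, u, d, rfl, hu, h⟩
    simpa [swapPairs, swapPairs_append hu] using h

/-- The beginnings of length `2 k + 3` of the clusters that start with `k + 1` occurrences at odd
places: their number for a given first letter `p` and a given next letter `q`. -/
theorem sum_isRun {n k p q : ℕ} (hpq : p < q) :
    (∑ B ∈ (Finset.Icc 1 n).powersetCard (2 * k + 3), ∑ v ∈ words B,
      if v.head? = some p ∧ IsRun (k + 1) (v ++ [q]) then 1 else 0) =
      (q - p - 1).choose (2 * k) * (p - 1) * (n - q) := by
  have hc : (q - p - 1).choose (2 * k) * (p - 1) * (n - q) =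
      ((Finset.Ioo p q).powersetCard (2 * k) ×ˢ Finset.Ico 1 p ×ˢ Finset.Ioc q n).card := by
    simp [mul_assoc]
  rw [hc, Finset.sum_sigma', ← Finset.card_filter]
  symm
  -- The increasing chain fixes the order of the letters, so the set `M` of middle letters and the
  -- outer letters `a`, `d` determine the word.
  refine Finset.card_bij (fun x _ => ⟨(p :: x.2.1 :: (swapPairs x.1.sort ++ [x.2.2])).toFinset,
    p :: x.2.1 :: (swapPairs x.1.sort ++ [x.2.2])⟩) ?_ ?_ ?_
  · rintro ⟨M, a, d⟩ h
    simp only [Finset.mem_product, Finset.mem_powersetCard, Finset.mem_Ico, Finset.mem_Ioc] at h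
    obtain ⟨⟨hM, hMc⟩, ha, hd⟩ := h
    have hM' : ∀ x ∈ M, p < x ∧ x < q := fun x hx => Finset.mem_Ioo.1 (hM hx)
    have hlen : (swapPairs M.sort).length = 2 * k := by
      rw [(perm_swapPairs _).length_eq, Finset.length_sort, hMc]
    have hmem : ∀ x, x ∈ swapPairs M.sort ↔ x ∈ M := by
      intro x
      rw [(perm_swapPairs _).mem_iff, Finset.mem_sort]
    have hnd : (p :: a :: (swapPairs M.sort ++ [d])).Nodup := by
      have : (swapPairs M.sort).Nodup := (perm_swapPairs _).nodup_iff.2 (Finset.sort_nodup _ _)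
      simp only [List.nodup_cons, List.nodup_append, List.mem_cons, List.mem_append, hmem,
        List.not_mem_nil, or_false, not_or, this]
      refine ⟨⟨by omega, fun h => ?_, by omega⟩, ⟨fun h => ?_, by omega⟩, trivial, by simp, ?_⟩
      · have := hM' _ h
        omega
      · have := hM' _ h
        omega
      · rintro x hx _ rfl
        have := hM' _ hx
        omega
    simp only [Finset.mem_filter, Finset.mem_sigma, Finset.mem_powersetCard, mem_words]
    refine ⟨⟨⟨?_, ?_⟩, hnd, trivial⟩, rfl, ?_⟩
    · intro x hx
      simp only [List.mem_toFinset, List.mem_cons, List.mem_append, hmem, List.not_mem_nil,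
        or_false] at hx
      rw [Finset.mem_Icc]
      rcases hx with rfl | rfl | hx | rfl
      · omega
      · omega
      · have := hM' _ hx
        omega
      · omega
    · rw [List.toFinset_card_of_nodup hnd]
      simp [hlen]
    · rw [isRun_append_singleton_iff (by simp [hlen])]
      refine ⟨p, a, _, d, rfl, hlen, ?_⟩
      rw [swapPairs_swapPairs]
      have hs : M.sort.Pairwise (· < ·) := (Finset.sortedLT_sort M).pairwise
      simp only [List.pairwise_cons, List.pairwise_append, List.mem_cons, List.mem_append,
        Finset.mem_sort, List.not_mem_nil, or_false, hs, true_and]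
      refine ⟨?_, ?_, ⟨by simp; omega, by simp⟩, ?_⟩
      · rintro x (rfl | hx | rfl | rfl)
        · omega
        · have := hM' _ hx
          omega
        · omega
        · omega
      · rintro x (hx | rfl | rfl)
        · have := hM' _ hx
          omega
        · omega
        · omega
      · rintro x hx y (rfl | rfl)
        · have := hM' _ hx
          omega
        · have := hM' _ hx
          omega
  · rintro ⟨M, a, d⟩ - ⟨M', a', d'⟩ - h
    have h1 := eq_of_heq (Sigma.mk.inj h).2
    simp only [List.cons.injEq, true_and] at h1
    obtain ⟨rfl, h2⟩ := h1
    obtain ⟨h3, h4⟩ := List.append_inj' h2 rfl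
    have h5 : M.sort = M'.sort := by
      rw [← swapPairs_swapPairs (M.sort (· ≤ ·)), h3, swapPairs_swapPairs]
    have h6 : M = M' := by
      rw [← Finset.sort_toFinset M (· ≤ ·), h5, Finset.sort_toFinset]
    simp only [List.cons.injEq, and_true] at h4
    rw [h6, h4]
  · rintro ⟨B, v⟩ h
    simp only [Finset.mem_filter, Finset.mem_sigma, Finset.mem_powersetCard, mem_words] at h
    obtain ⟨⟨⟨hB, hBc⟩, hv, rfl⟩, hp, hr⟩ := h
    rw [List.toFinset_card_of_nodup hv] at hBc
    obtain ⟨p', a, u, d, rfl, hu, hs⟩ := (isRun_append_singleton_iff hBc).1 hr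
    obtain rfl : p' = p := by simpa using hp
    have hmem : ∀ x, x ∈ swapPairs u ↔ x ∈ u := fun x => (perm_swapPairs u).mem_iff
    simp only [List.pairwise_cons, List.pairwise_append, List.mem_cons, List.mem_append, hmem,
      List.not_mem_nil, or_false] at hs
    obtain ⟨h1, h2, h3, h4, h5⟩ := hs
    -- The swapped middle part is already increasing, so sorting its letters recovers it.
    have hsort : (swapPairs u).toFinset.sort = swapPairs u :=
      (List.toFinset_sort (· ≤ ·) (h3.imp fun h => h.ne)).2 (h3.imp fun h => h.le)
    have haB : a ∈ Finset.Icc 1 n := hB (by simp)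
    have hdB : d ∈ Finset.Icc 1 n := hB (by simp)
    rw [Finset.mem_Icc] at haB hdB
    refine ⟨((swapPairs u).toFinset, a, d), ?_, ?_⟩
    · simp only [Finset.mem_product, Finset.mem_powersetCard, Finset.mem_Ico, Finset.mem_Ioc]
      refine ⟨⟨?_, ?_⟩, ⟨haB.1, h1 _ (Or.inl rfl)⟩, h4.1 _ rfl, hdB.2⟩
      · intro x hx
        rw [List.mem_toFinset, hmem] at hx
        exact Finset.mem_Ioo.2 ⟨h2 _ (Or.inl hx), h5 _ hx _ (Or.inl rfl)⟩
      · rw [List.toFinset_card_of_nodup (h3.imp fun h => h.ne), (perm_swapPairs _).length_eq, hu]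
    · simp only [hsort, swapPairs_swapPairs]

/-- The `2k + 2` letters of `p :: a :: u` lie below `q` and `d` lies above it, so removing `B`
lowers the rank of `q` by `2k + 2`. -/
theorem rankIn_sdiff_of_isRun {n k q : ℕ} {v : List ℕ} {B : Finset ℕ}
    (hB : B ∈ (Finset.Icc 1 n).powersetCard (2 * k + 3)) (hv : v ∈ words B)
    (hr : IsRun (k + 1) (v ++ [q])) (hq : q ∈ Finset.Icc 1 n) :
    q ∈ Finset.Icc 1 n \ B ∧ rankIn (Finset.Icc 1 n \ B) q = q - (2 * k + 2) := by
  rw [Finset.mem_powersetCard] at hB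
  obtain ⟨hn, rfl⟩ := mem_words.1 hv
  rw [List.toFinset_card_of_nodup hn] at hB
  obtain ⟨p, a, u, d, rfl, hu, hs⟩ := (isRun_append_singleton_iff hB.2).1 hr
  have hmem : ∀ x, x ∈ swapPairs u ↔ x ∈ u := fun x => (perm_swapPairs u).mem_iff
  simp only [List.pairwise_cons, List.pairwise_append, List.mem_cons, List.mem_append, hmem,
    List.not_mem_nil, or_false] at hs
  obtain ⟨h1, h2, h3, h4, h5⟩ := hs
  have hd : q < d := h4.1 d rfl
  have hlow : ∀ x ∈ p :: a :: u, x < q := by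
    intro x hx
    simp only [List.mem_cons] at hx
    rcases hx with rfl | rfl | hx
    · exact h2 _ (Or.inr (Or.inl rfl))
    · exact h1 _ (Or.inr (Or.inr (Or.inl rfl)))
    · exact h5 _ hx _ (Or.inl rfl)
  rw [Finset.mem_Icc] at hq
  have hiff : ∀ x, x ∈ p :: a :: (u ++ [d]) ↔ x ∈ p :: a :: u ∨ x = d := by
    intro x
    simp [or_assoc]
  refine ⟨?_, ?_⟩
  · rw [Finset.mem_sdiff, Finset.mem_Icc, List.mem_toFinset, hiff]
    refine ⟨hq, ?_⟩
    rintro (h | h)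
    · exact lt_irrefl _ (hlow q h)
    · omega
  · have hn' : (p :: a :: u).Nodup := by
      have : (p :: a :: u ++ [d]).Nodup := hn
      exact (List.nodup_append.1 this).1
    have he : (Finset.Icc 1 n \ (p :: a :: (u ++ [d])).toFinset).filter (· ≤ q) =
        Finset.Icc 1 q \ (p :: a :: u).toFinset := by
      ext x
      rw [Finset.mem_filter, Finset.mem_sdiff, Finset.mem_sdiff, Finset.mem_Icc, Finset.mem_Icc,
        List.mem_toFinset, List.mem_toFinset, hiff]
      constructor
      · rintro ⟨⟨h6, h7⟩, h8⟩
        exact ⟨⟨h6.1, h8⟩, fun h => h7 (Or.inl h)⟩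
      · rintro ⟨h6, h7⟩
        refine ⟨⟨⟨h6.1, by omega⟩, ?_⟩, h6.2⟩
        rintro (h | h)
        · exact h7 h
        · omega
    rw [rankIn, he, Finset.card_sdiff_of_subset, List.toFinset_card_of_nodup hn']
    · simp [hu]
    · intro x hx
      rw [List.mem_toFinset] at hx
      have h6 := hlow x hx
      have h7 := Finset.mem_Icc.1 (hB.1 (List.mem_toFinset.2 ((hiff x).2 (Or.inl hx))))
      exact Finset.mem_Icc.2 ⟨h7.1, h6.le⟩

/-- The word is cut just before the last letter `q` of the run. For fixed `q`, the number of
continuations does not depend on the prefix, so the count factors. -/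
theorem sum_words_isRun {n k l p : ℕ} (hn : 2 * k + 4 ≤ n) (hp : 1 ≤ p) :
    (∑ w ∈ words (Finset.Icc 1 n), if w.head? = some p then
      (if IsRun (k + 1) w then wordClusters l (w.drop (2 * k + 3)) else 0) else 0) =
    ∑ q ∈ (Finset.Icc (2 * k + 3) n).filter (fun q => p < q),
      (q - p - 1).choose (2 * k) * (p - 1) * (n - q) *
        clusterCountFirst perm2143 (n - (2 * k + 3)) l (q - (2 * k + 2)) := by
  -- Summing over a guessed value of the first letter after the cut makes the run condition depend
  -- on the prefix and `q` alone.
  have h1 : ∀ w ∈ words (Finset.Icc 1 n), (if w.head? = some p then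
      (if IsRun (k + 1) w then wordClusters l (w.drop (2 * k + 3)) else 0) else 0) =
      ∑ q ∈ Finset.Icc 1 n, if (w.take (2 * k + 3)).head? = some p ∧
        IsRun (k + 1) (w.take (2 * k + 3) ++ [q]) then
        (if (w.drop (2 * k + 3)).head? = some q then wordClusters l (w.drop (2 * k + 3)) else 0)
        else 0 := by
    intro w hw
    have hl : w.length = n := by simpa using length_of_mem_words hw
    have hlt : 2 * k + 3 < w.length := by omega
    have hd : (w.drop (2 * k + 3)).head? = some w[2 * k + 3] := by
      rw [List.head?_drop, List.getElem?_eq_getElem hlt]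
    have ht : (w.take (2 * k + 3)).head? = w.head? := by
      rw [List.head?_take, if_neg (by omega)]
    have hr : IsRun (k + 1) (w.take (2 * k + 3) ++ [w[2 * k + 3]]) ↔ IsRun (k + 1) w := by
      rw [List.take_append_getElem, isRun_take (by omega)]
    rw [Finset.sum_eq_single w[2 * k + 3]]
    · rw [if_pos hd, ht, if_congr (and_congr_right' hr) rfl rfl, ite_and]
    · intro q _ hq
      rw [hd, if_neg fun h => hq (Option.some.inj h).symm, ite_self]
    · intro h
      exact absurd ((mem_of_mem_words hw _).1 (List.getElem_mem _)) h
  rw [Finset.sum_congr rfl h1, sum_words_take_drop _ _ (by simp; omega) fun v u =>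
    ∑ q ∈ Finset.Icc 1 n, if v.head? = some p ∧ IsRun (k + 1) (v ++ [q]) then
      (if u.head? = some q then wordClusters l u else 0) else 0]
  have h2 : ∀ B ∈ (Finset.Icc 1 n).powersetCard (2 * k + 3), (∑ v ∈ words B,
      ∑ u ∈ words (Finset.Icc 1 n \ B), ∑ q ∈ Finset.Icc 1 n,
        if v.head? = some p ∧ IsRun (k + 1) (v ++ [q]) then
          (if u.head? = some q then wordClusters l u else 0) else 0) =
      ∑ q ∈ Finset.Icc 1 n,
        (∑ v ∈ words B, if v.head? = some p ∧ IsRun (k + 1) (v ++ [q]) then 1 else 0) *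
          clusterCountFirst perm2143 (n - (2 * k + 3)) l (q - (2 * k + 2)) := by
    intro B hB
    have hc : (Finset.Icc 1 n \ B).card = n - (2 * k + 3) := by
      rw [Finset.mem_powersetCard] at hB
      rw [Finset.card_sdiff_of_subset hB.1, hB.2]
      simp
    simp_rw [Finset.sum_mul]
    conv_rhs => rw [Finset.sum_comm]
    refine Finset.sum_congr rfl fun v hv => ?_
    rw [Finset.sum_comm]
    refine Finset.sum_congr rfl fun q hq => ?_
    split_ifs with h
    · obtain ⟨h3, h4⟩ := rankIn_sdiff_of_isRun hB hv h.2 hq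
      rw [(orderInvariant_wordClusters l).sum_words_head h3, hc, h4, one_mul,
        clusterCountFirst_perm2143]
    · simp
  rw [Finset.sum_congr rfl h2, Finset.sum_comm]
  simp_rw [← Finset.sum_mul]
  symm
  refine (Finset.sum_congr rfl fun q hq => ?_).trans (Finset.sum_subset ?_ ?_)
  · rw [sum_isRun (Finset.mem_filter.1 hq).2]
  · intro q hq
    rw [Finset.mem_filter, Finset.mem_Icc] at hq
    exact Finset.mem_Icc.2 (by omega)
  -- The values of `q` outside the stated range contribute nothing. If `q ≤ p`, no run exists. If `p
  -- < q < 2k + 3`, then either `p = 1` and no `a` is available, or fewer than `2k` letters lie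
  -- between `p` and `q`.
  · intro q hq hq'
    rw [Finset.mem_filter, Finset.mem_Icc] at hq'
    rw [Finset.mem_Icc] at hq
    by_cases hpq : p < q
    · rw [sum_isRun hpq]
      rcases Nat.lt_or_ge p 2 with h | h
      · simp [show p - 1 = 0 by omega]
      · rw [Nat.choose_eq_zero_of_lt (by omega)]
        simp
    · rw [Finset.sum_eq_zero, zero_mul]
      intro B hB
      refine Finset.sum_eq_zero fun v hv => if_neg ?_
      rintro ⟨h3, h4⟩
      have hl : v.length = 2 * k + 3 := by
        rw [length_of_mem_words hv, (Finset.mem_powersetCard.1 hB).2]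
      obtain ⟨p', a, u, d, rfl, hu, hs⟩ := (isRun_append_singleton_iff hl).1 h4
      obtain rfl : p' = p := by simpa using h3
      rw [List.pairwise_cons, List.pairwise_cons] at hs
      exact hpq (hs.2.1 q (by simp))

/-! ### The recurrence, initial values and conclusion -/

theorem clusterCountFirst_perm2143_recurrence (n l p : ℕ) (hn : 4 ≤ n) (hp : 1 ≤ p) :
    clusterCountFirst perm2143 n l p =
      ∑ k ∈ (Finset.Icc 1 l).filter (fun k => 2 * k + 2 ≤ n),
        ∑ q ∈ (Finset.Icc (2 * k + 1) n).filter (fun q => p < q),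
          (q - p - 1).choose (2 * k - 2) * (p - 1) * (n - q) *
            clusterCountFirst perm2143 (n - 2 * k - 1) (l - k) (q - 2 * k) := by
  have h1 : ∀ w ∈ words (Finset.Icc 1 n), (if w.head? = some p then wordClusters l w else 0) =
      ∑ k ∈ Finset.range l, if w.head? = some p then
        (if IsRun (k + 1) w then wordClusters (l - (k + 1)) (w.drop (2 * (k + 1) + 1)) else 0)
        else 0 := by
    intro w hw
    have hl : w.length = n := by simpa using length_of_mem_words hw
    rw [wordClusters_eq_sum_isRun l w (by omega)]
    split_ifs with h
    · rfl
    · simp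
  rw [clusterCountFirst_perm2143, Finset.sum_congr rfl h1, Finset.sum_comm, Finset.sum_filter,
    Finset.range_eq_Ico, Finset.sum_Ico_add' (fun k => ∑ w ∈ words (Finset.Icc 1 n),
      if w.head? = some p then
        (if IsRun k w then wordClusters (l - k) (w.drop (2 * k + 1)) else 0) else 0) 0 l 1]
  refine Finset.sum_congr rfl fun k hk => ?_
  obtain ⟨k, rfl⟩ : ∃ j, k = j + 1 := ⟨k - 1, by
    have := (Finset.mem_Ico.1 hk).1
    omega⟩
  split_ifs with h
  -- After the shift of index, `k + 1` is the number of leading occurrences at distance 2. If `n` is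
  -- too small for them, the term vanishes.
  · exact sum_words_isRun (by omega) hp
  · refine Finset.sum_eq_zero fun w hw => ?_
    have hl : w.length = n := by simpa using length_of_mem_words hw
    have hr : ¬ IsRun (k + 1) w := fun hr => by
      have := IsRun.le_length hr
      omega
    rw [if_neg hr, ite_self]

/-- In the initial 2143 one letter is smaller than the first and two are larger. -/
theorem two_le_of_wordClusters_ne_zero {n l : ℕ} {w : List ℕ} (hn : 2 ≤ n)
    (hw : w ∈ words (Finset.Icc 1 n)) (h : wordClusters l w ≠ 0) :
    ∃ p, w.head? = some p ∧ 2 ≤ p ∧ p + 2 ≤ n := by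
  have hl : w.length = n := by simpa using length_of_mem_words hw
  cases l with
  | zero =>
    rw [wordClusters, if_neg (by omega)] at h
    exact absurd rfl h
  | succ l =>
    rw [wordClusters] at h
    split_ifs at h with hs
    · obtain ⟨a, b, c, d, v, rfl, h1, h2, h3⟩ := starts2143_iff.1 hs
      have hb := Finset.mem_Icc.1 ((mem_of_mem_words hw b).1 (by simp))
      have hc := Finset.mem_Icc.1 ((mem_of_mem_words hw c).1 (by simp))
      exact ⟨a, rfl, by omega, by omega⟩
    · exact absurd rfl h

theorem clusterCount_perm2143_eq_sum (n l : ℕ) (hn : 2 ≤ n) :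
    clusterCount perm2143 n l =
      ∑ p ∈ Finset.Icc 2 (n - 2), clusterCountFirst perm2143 n l p := by
  simp_rw [clusterCountFirst_perm2143]
  rw [clusterCount_perm2143, Finset.sum_comm]
  refine Finset.sum_congr rfl fun w hw => ?_
  rcases eq_or_ne (wordClusters l w) 0 with h | h
  · simp [h]
  · obtain ⟨p, hp, h1, h2⟩ := two_le_of_wordClusters_ne_zero hn hw h
    simp only [hp, Option.some.injEq]
    rw [Finset.sum_ite_eq, if_pos (Finset.mem_Icc.2 (by omega))]

theorem clusterCountFirst_perm2143_one (l p : ℕ) :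
    clusterCountFirst perm2143 1 l p = if l = 0 ∧ p = 1 then 1 else 0 := by
  have hw : ∀ σ : Perm (Fin 1), permWord σ = [1] := by
    intro σ
    simp [permWord]
  rw [clusterCountFirst_perm2143, ← sum_permWord]
  simp only [hw]
  cases l with
  | zero => simp [wordClusters, eq_comm]
  | succ l => simp [wordClusters, Starts2143]

theorem clusterCountFirst_perm2143_eq_zero {n : ℕ} (h2 : 2 ≤ n) (h3 : n ≤ 3) (l p : ℕ) :
    clusterCountFirst perm2143 n l p = 0 := by
  rw [clusterCountFirst_perm2143]
  refine Finset.sum_eq_zero fun w hw => ?_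
  have : wordClusters l w = 0 := by
    by_contra h
    obtain ⟨p, -, h4, h5⟩ := two_le_of_wordClusters_ne_zero h2 hw h
    omega
  simp [this]

theorem mainTheorem6 :
    (∀ n l : ℕ, 2 ≤ n →
      clusterCount perm2143 n l =
        ∑ p ∈ Finset.Icc 2 (n - 2), clusterCountFirst perm2143 n l p) ∧
    (∀ l p : ℕ, clusterCountFirst perm2143 1 l p = if l = 0 ∧ p = 1 then 1 else 0) ∧
    (∀ l p : ℕ, clusterCountFirst perm2143 2 l p = 0) ∧
    (∀ l p : ℕ, clusterCountFirst perm2143 3 l p = 0) ∧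
    (∀ n l p : ℕ, 4 ≤ n → 1 ≤ p →
      clusterCountFirst perm2143 n l p =
        ∑ k ∈ (Finset.Icc 1 l).filter (fun k => 2 * k + 2 ≤ n),
          ∑ q ∈ (Finset.Icc (2 * k + 1) n).filter (fun q => p < q),
            (q - p - 1).choose (2 * k - 2) * (p - 1) * (n - q) *
              clusterCountFirst perm2143 (n - 2 * k - 1) (l - k) (q - 2 * k)) ∧
    occurrenceGF perm2143 * (1 - PowerSeries.X - clusterGFShifted perm2143) = 1 :=
  ⟨clusterCount_perm2143_eq_sum, clusterCountFirst_perm2143_one,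
    clusterCountFirst_perm2143_eq_zero le_rfl (by omega),
    clusterCountFirst_perm2143_eq_zero (by omega) le_rfl,
    clusterCountFirst_perm2143_recurrence, occurrenceGF_perm2143_mul⟩
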